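/- Work over $\mathbb{Q}$. Let $\mathfrak{Lie}$ be the Lie operad, so that for a finite set $S$ the vector space $\mathfrak{Lie}(S)$ is the multilinear part of the free Lie algebra on $S$, and let $\mathbf{Cat}\,\mathfrak{Lie}$ be the associated PROP: the $\mathbb{Q}$-linear category with set of objects $\mathbb{N}$, with $$\mathbf{Cat}\,\mathfrak{Lie}(m,n)=\bigoplus_{f:\{1,\dots,m\}\twoheadrightarrow\{1,\dots,n\}}\ \bigotimes_{i=1}^n \mathfrak{Lie}(f^{-1}(i)),$$ the sum being over surjections, and with composition induced by operadic composition. Write $-\boxplus 1$ for the functor $\mathbf{Cat}\,\mathfrak{Lie}\to\mathbf{Cat}\,\mathfrak{Lie}$ given by $n\mapsto n+1$ and by adjoining the unit of $\mathfrak{Lie}(1)$ at the last place. A left module over a $\mathbb{Q}$-linear category is a $\mathbb{Q}$-linear functor from it to $\mathbb{Q}$-vector spaces; morphisms are natural transformations. For a left $\mathbf{Cat}\,\mathfrak{Lie}$-module $M$ let $\delta M = M\circ(-\boxplus 1)$, so that $(\delta M)(n)=M(n+1)$. For $n\in\mathbb{N}$ let $\mu(n)\in\mathbf{Cat}\,\mathfrak{Lie}(n+1,n)$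 be the sum, over the $n$ surjections $f:\{1,\dots,n+1\}\to\{1,\dots,n\}$ that restrict to the identity on $\{1,\dots,n\}$, of the element of the summand indexed by $f$ given by the bracket $[x_i,x_{n+1}]$ for $i=f(n+1)$ and by the units $x_j$ for $j\neq i$ (so $\mu(0)=0$). The $\mu(n)$ define a natural transformation $\widetilde\mu:\delta\to\mathrm{Id}$ of endofunctors of the category $\mathcal F_{\mathfrak{Lie}}$ of left $\mathbf{Cat}\,\mathfrak{Lie}$-modules, with $\widetilde\mu_M(n):M(n+1)\to M(n)$ the action of $\mu(n)$. Let $\mathcal F^{\mu}_{\mathfrak{Lie}}\subset\mathcal F_{\mathfrak{Lie}}$ be the full subcategory of the modules $M$ with $\widetilde\mu_M=0$. Let $\delta^{(1)}\mathbf{Cat}\,\mathfrak{Lie}(m,n)\subset\mathbf{Cat}\,\mathfrak{Lie}(m,n+1)$ be the sum of the summands indexed by the surjections $f$ with $|f^{-1}(n+1)|=1$, and let $\widetilde\mu^{(1)}:\delta^{(1)}\mathbf{Cat}\,\mathfrak{Lie}(m,n)\to\mathbf{Cat}\,\mathfrak{Lie}(m,n)$ be $x\mapsto\mu(n)\circ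 x$. Let $\mathbf H_0$ be the degree zero homology of the differential graded category $(\mathbf{Cat}\,\mathfrak{Lie}\oplus\delta^{(1)}\mathbf{Cat}\,\mathfrak{Lie}[1],\widetilde\mu^{(1)})$, that is, the $\mathbb{Q}$-linear category with set of objects $\mathbb{N}$, with $\mathbf H_0(m,n)=\mathbf{Cat}\,\mathfrak{Lie}(m,n)/\operatorname{im}\widetilde\mu^{(1)}$ and with composition induced by that of $\mathbf{Cat}\,\mathfrak{Lie}$. **Theorem.** The projection $\mathbf{Cat}\,\mathfrak{Lie}\to\mathbf H_0$ is a full $\mathbb{Q}$-linear functor, and there is an equivalence between $\mathcal F^{\mu}_{\mathfrak{Lie}}$ and the category of left $\mathbf H_0$-modules under which the inclusion $\mathcal F^{\mu}_{\mathfrak{Lie}}\hookrightarrow\mathcal F_{\mathfrak{Lie}}$ corresponds, up to natural isomorphism, to restriction along $\mathbf{Cat}\,\mathfrak{Lie}\to\mathbf H_0$. -/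

import Mathlib

open CategoryTheory

universe u

noncomputable section

namespace LieOperad

open scoped TensorProduct DirectSum

/-! ### The Lie operad -/

/-- The free `ℚ`-Lie algebra on generators `x_0, …, x_{m-1}`. -/
abbrev FreeLie (m : ℕ) : Type := FreeLieAlgebra ℚ (Fin m)

/-- `IsMonomial S c`: `c` is an iterated bracket of generators in which each generator `x_i` with
`i ∈ S` occurs exactly once, and no other generator occurs. -/
inductive IsMonomial {m : ℕ} : Finset (Fin m) → FreeLie m → Prop
  | gen (i : Fin m) : IsMonomial {i} (FreeLieAlgebra.of ℚ i)
  | bracket {S T : Finset (Fin m)} {a b : FreeLie m} (hST : Disjoint S T)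
      (ha : IsMonomial S a) (hb : IsMonomial T b) : IsMonomial (S ∪ T) ⁅a, b⁆

/-- The Lie operad evaluated on the finite set `S`: the multilinear part, in the generators `x_i`
with `i ∈ S`, of the free Lie algebra. For `|S| = r` this is the usual `Lie(r)`, transported along
any bijection of `S` with `{1, …, r}`; it is zero for `S = ∅`. -/
def LieOn {m : ℕ} (S : Finset (Fin m)) : Submodule ℚ (FreeLie m) :=
  Submodule.span ℚ {a | IsMonomial S a}

/-- Substitution of `a_i` for the generator `x_i`. Restricted to multilinear parts, this is the
composition of the Lie operad. -/
def subst {m n : ℕ} (a : Fin n → FreeLie m) : FreeLie n →ₗ⁅ℚ⁆ FreeLie m :=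
  FreeLieAlgebra.lift ℚ a

theorem IsMonomial.nonempty {m : ℕ} {S : Finset (Fin m)} {c : FreeLie m}
    (h : IsMonomial S c) : S.Nonempty := by
  induction h with
  | gen i => exact ⟨i, by simp⟩
  | bracket _ _ _ h1 _ => exact h1.mono Finset.subset_union_left

theorem LieOn_induction {m : ℕ} {p : Finset (Fin m) → FreeLie m → Prop}
    (gen : ∀ i, p {i} (FreeLieAlgebra.of ℚ i))
    (bracket : ∀ S T a b, S.Nonempty → T.Nonempty → Disjoint S T → a ∈ LieOn S → b ∈ LieOn T →
      p S a → p T b → p (S ∪ T) ⁅a, b⁆)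
    (zero : ∀ S, p S 0)
    (add : ∀ S a b, a ∈ LieOn S → b ∈ LieOn S → p S a → p S b → p S (a + b))
    (smul : ∀ S (r : ℚ) a, a ∈ LieOn S → p S a → p S (r • a))
    {S : Finset (Fin m)} {c : FreeLie m} (hc : c ∈ LieOn S) : p S c := by
  induction hc using Submodule.span_induction with
  | zero => exact zero S
  | add x y h h' hx hy => exact add _ _ _ h h' hx hy
  | smul r x h hx => exact smul _ _ _ h hx
  | mem x hx =>
    have hx : IsMonomial S x := hx
    clear c
    induction hx with
    | gen i => exact gen i
    | bracket hd ha hb h1 h2 =>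
      exact bracket _ _ _ _ ha.nonempty hb.nonempty hd (Submodule.subset_span ha) (Submodule.subset_span hb) (h1 ha) (h2 hb)

theorem of_mem_LieOn {m : ℕ} (i : Fin m) : FreeLieAlgebra.of ℚ i ∈ LieOn {i} :=
  Submodule.subset_span (.gen i)

theorem lie_mem_LieOn {m : ℕ} {S T : Finset (Fin m)} (hST : Disjoint S T) {a b : FreeLie m}
    (ha : a ∈ LieOn S) (hb : b ∈ LieOn T) : ⁅a, b⁆ ∈ LieOn (S ∪ T) := by
  induction ha using Submodule.span_induction with
  | zero => simp
  | add x y _ _ hx hy => rw [add_lie]; exact add_mem hx hy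
  | smul r x _ hx => rw [smul_lie]; exact Submodule.smul_mem _ _ hx
  | mem x hx =>
    induction hb using Submodule.span_induction with
    | zero => simp
    | add x y _ _ hx hy => rw [lie_add]; exact add_mem hx hy
    | smul r x _ hx => rw [lie_smul]; exact Submodule.smul_mem _ _ hx
    | mem y hy => exact Submodule.subset_span (.bracket hST hx hy)

@[simp] theorem subst_of {m n : ℕ} (a : Fin n → FreeLie m) (i : Fin n) :
    subst a (FreeLieAlgebra.of ℚ i) = a i :=
  FreeLieAlgebra.lift_of_apply ..

theorem subst_of_self {m : ℕ} (c : FreeLie m) :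
    subst (fun i => FreeLieAlgebra.of ℚ i) c = c := by
  have : subst (fun i : Fin m => FreeLieAlgebra.of ℚ i) = LieHom.id :=
    FreeLieAlgebra.hom_ext (by simp)
  rw [this]; rfl

theorem subst_subst {l m n : ℕ} (a : Fin m → FreeLie l) (b : Fin n → FreeLie m) (c : FreeLie n) :
    subst a (subst b c) = subst (fun i => subst a (b i)) c := by
  have : (subst a).comp (subst b) = subst (fun i => subst a (b i)) :=
    FreeLieAlgebra.hom_ext (by simp)
  rw [← this]; rfl

theorem subst_congr {m n : ℕ} {S : Finset (Fin n)} {a a' : Fin n → FreeLie m}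
    (h : ∀ i ∈ S, a i = a' i) {c : FreeLie n} (hc : c ∈ LieOn S) : subst a c = subst a' c := by
  revert h
  refine LieOn_induction (p := fun S c => (∀ i ∈ S, a i = a' i) → subst a c = subst a' c)
    ?_ ?_ ?_ ?_ ?_ hc
  · intro i h; simpa using h
  · intro S T x y _ _ _ _ _ h1 h2 h
    rw [LieHom.map_lie, LieHom.map_lie, h1 fun i hi => h i (by simp [hi]),
      h2 fun i hi => h i (by simp [hi])]
  · intro S _; simp
  · intro S x y _ _ hx hy h; simp only [map_add, hx h, hy h]
  · intro S r x _ hx h; simp only [map_smul, hx h]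

theorem subst_update_of_notMem {m n : ℕ} {S : Finset (Fin n)} (a : Fin n → FreeLie m) {j : Fin n}
    (hj : j ∉ S) (z : FreeLie m) {c : FreeLie n} (hc : c ∈ LieOn S) :
    subst (Function.update a j z) c = subst a c :=
  subst_congr (fun i hi => by
    rw [Function.update_of_ne]
    rintro rfl
    exact hj hi) hc

theorem subst_mem {m n : ℕ} {S : Finset (Fin n)} {T : Fin n → Finset (Fin m)}
    (hT : ∀ i j, i ≠ j → Disjoint (T i) (T j)) {a : Fin n → FreeLie m}
    (ha : ∀ i ∈ S, a i ∈ LieOn (T i)) {c : FreeLie n} (hc : c ∈ LieOn S) :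
    subst a c ∈ LieOn (S.biUnion T) := by
  revert ha
  refine LieOn_induction (p := fun S c => (∀ i ∈ S, a i ∈ LieOn (T i)) →
    subst a c ∈ LieOn (S.biUnion T)) ?_ ?_ ?_ ?_ ?_ hc
  · intro i h; simpa using h
  · intro S₁ S₂ x y _ _ hd _ _ h1 h2 ha
    rw [LieHom.map_lie, Finset.union_biUnion]
    refine lie_mem_LieOn ?_ (h1 fun i hi => ha i (by simp [hi]))
      (h2 fun i hi => ha i (by simp [hi]))
    simp only [Finset.disjoint_biUnion_left, Finset.disjoint_biUnion_right]
    intro i hi j hj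
    refine hT _ _ ?_
    rintro rfl
    first
      | exact Finset.disjoint_left.1 hd hi hj
      | exact Finset.disjoint_left.1 hd hj hi
  · intro S _; simp
  · intro S x y _ _ hx hy h; rw [map_add]; exact add_mem (hx h) (hy h)
  · intro S r x _ hx h; rw [map_smul]; exact Submodule.smul_mem _ _ (hx h)

theorem subst_update_add {m n : ℕ} {S : Finset (Fin n)} (a : Fin n → FreeLie m) {j : Fin n}
    (hj : j ∈ S) (x y : FreeLie m) {c : FreeLie n} (hc : c ∈ LieOn S) :
    subst (Function.update a j (x + y)) c =
      subst (Function.update a j x) c + subst (Function.update a j y) c := by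
  revert hj
  refine LieOn_induction (p := fun S c => j ∈ S → subst (Function.update a j (x + y)) c =
      subst (Function.update a j x) c + subst (Function.update a j y) c) ?_ ?_ ?_ ?_ ?_ hc
  · intro i h
    obtain rfl : j = i := by simpa using h
    simp
  · intro S₁ S₂ b c _ _ hd hb hc h1 h2 hj
    simp only [LieHom.map_lie]
    rcases Finset.mem_union.1 hj with h | h
    · have h' := Finset.disjoint_left.1 hd h
      rw [h1 h, subst_update_of_notMem _ h' _ hc, subst_update_of_notMem _ h' _ hc,
        subst_update_of_notMem _ h' _ hc, add_lie]
    · have h' := Finset.disjoint_right.1 hd h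
      rw [h2 h, subst_update_of_notMem _ h' _ hb, subst_update_of_notMem _ h' _ hb,
        subst_update_of_notMem _ h' _ hb, lie_add]
  · intro S _; simp only [map_zero, add_zero]
  · intro S b c _ _ hb hc h; simp only [map_add, hb h, hc h]; abel
  · intro S r c _ hc h; simp only [map_smul, hc h, smul_add]

theorem subst_update_smul {m n : ℕ} {S : Finset (Fin n)} (a : Fin n → FreeLie m) {j : Fin n}
    (hj : j ∈ S) (r : ℚ) (x : FreeLie m) {c : FreeLie n} (hc : c ∈ LieOn S) :
    subst (Function.update a j (r • x)) c = r • subst (Function.update a j x) c := by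
  revert hj
  refine LieOn_induction (p := fun S c => j ∈ S → subst (Function.update a j (r • x)) c =
      r • subst (Function.update a j x) c) ?_ ?_ ?_ ?_ ?_ hc
  · intro i h
    obtain rfl : j = i := by simpa using h
    simp
  · intro S₁ S₂ b c _ _ hd hb hc h1 h2 hj
    simp only [LieHom.map_lie]
    rcases Finset.mem_union.1 hj with h | h
    · have h' := Finset.disjoint_left.1 hd h
      rw [h1 h, subst_update_of_notMem _ h' _ hc, subst_update_of_notMem _ h' _ hc, smul_lie]
    · have h' := Finset.disjoint_right.1 hd h
      rw [h2 h, subst_update_of_notMem _ h' _ hb, subst_update_of_notMem _ h' _ hb, lie_smul]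
  · intro S _; simp only [map_zero, smul_zero]
  · intro S b c _ _ hb hc h; simp only [map_add, hb h, hc h, smul_add]
  · intro S s c _ hc h; simp only [map_smul, hc h, smul_comm r s]

theorem subst_deriv {m n : ℕ} {S : Finset (Fin n)} (a : Fin n → FreeLie m) (z : FreeLie m)
    {c : FreeLie n} (hc : c ∈ LieOn S) :
    ∑ i ∈ S, subst (Function.update a i ⁅a i, z⁆) c = ⁅subst a c, z⁆ := by
  refine LieOn_induction (p := fun S c =>
    ∑ i ∈ S, subst (Function.update a i ⁅a i, z⁆) c = ⁅subst a c, z⁆) ?_ ?_ ?_ ?_ ?_ hc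
  · intro i; simp
  · intro S₁ S₂ b c _ _ hd hb hc h1 h2
    simp only [LieHom.map_lie]
    rw [Finset.sum_union hd,
      Finset.sum_congr rfl fun i hi => by
        rw [subst_update_of_notMem _ (Finset.disjoint_left.1 hd hi) _ hc],
      Finset.sum_congr (s₁ := S₂) rfl fun i hi => by
        rw [subst_update_of_notMem _ (Finset.disjoint_right.1 hd hi) _ hb],
      ← sum_lie, ← lie_sum, h1, h2, lie_lie (subst a b) (subst a c) z,
      ← lie_skew ⁅subst a b, z⁆ (subst a c)]
    abel
  · intro S; simp
  · intro S b c _ _ hb hc; simp only [map_add, Finset.sum_add_distrib, hb, hc, add_lie]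
  · intro S s c _ hc; simp only [map_smul, ← Finset.smul_sum, hc, smul_lie]


/-! ### The category `CatLie` -/

/-- Surjections from `{0, …, m-1}` to `{0, …, n-1}`. -/
abbrev Surj (m n : ℕ) : Type := {f : Fin m → Fin n // Function.Surjective f}

/-- Composition of surjections. -/
def Surj.comp {m n t : ℕ} (g : Surj n t) (f : Surj m n) : Surj m t :=
  ⟨g.1 ∘ f.1, g.2.comp f.2⟩

/-- The fibre `f⁻¹(i)`. -/
def fibre {m n : ℕ} (f : Fin m → Fin n) (i : Fin n) : Finset (Fin m) :=
  Finset.univ.filter fun p => f p = i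

theorem mem_fibre {m n : ℕ} {f : Fin m → Fin n} {i : Fin n} {p : Fin m} :
    p ∈ fibre f i ↔ f p = i := by
  simp [fibre]

/-- The vector space `⨂_i Lie(f⁻¹(i))`. -/
abbrev CatLieSummand {m n : ℕ} (f : Surj m n) : Type :=
  ⨂[ℚ] i, (LieOn (fibre f.1 i) : Submodule ℚ (FreeLie m))

/-- `CatLie(m, n) = ⨁_f ⨂_i Lie(f⁻¹(i))`, the sum being over the surjections `f`. -/
def CatLieHom (m n : ℕ) : Type := ⨁ f : Surj m n, CatLieSummand f

instance CatLieHom.instAddCommGroup (m n : ℕ) : AddCommGroup (CatLieHom m n) :=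
  inferInstanceAs (AddCommGroup (⨁ f : Surj m n, CatLieSummand f))

instance CatLieHom.instModule (m n : ℕ) : Module ℚ (CatLieHom m n) :=
  inferInstanceAs (Module ℚ (⨁ f : Surj m n, CatLieSummand f))

/-- The inclusion of the summand of index `f`. -/
def incl {m n : ℕ} (f : Surj m n) : CatLieSummand f →ₗ[ℚ] CatLieHom m n :=
  DirectSum.lof ℚ (Surj m n) (fun h => CatLieSummand h) f

/-- The linear map out of `CatLie(m, n)` given on each summand. -/
def homLift {m n : ℕ} {E : Type} [AddCommGroup E] [Module ℚ E]
    (φ : ∀ f : Surj m n, CatLieSummand f →ₗ[ℚ] E) : CatLieHom m n →ₗ[ℚ] E :=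
  DirectSum.toModule ℚ (Surj m n) E φ

theorem homLift_incl {m n : ℕ} {E : Type} [AddCommGroup E] [Module ℚ E]
    (φ : ∀ f : Surj m n, CatLieSummand f →ₗ[ℚ] E) (f : Surj m n) (u : CatLieSummand f) :
    homLift φ (incl f u) = φ f u :=
  DirectSum.toModule_lof ..

theorem fibre_comp {m n t : ℕ} (g : Surj n t) (f : Surj m n) (k : Fin t) :
    (fibre g.1 k).biUnion (fibre f.1) = fibre (g.comp f).1 k := by
  ext p
  simp [mem_fibre, Surj.comp]

theorem fibre_disjoint {m n : ℕ} (f : Fin m → Fin n) (i j : Fin n) (h : i ≠ j) :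
    Disjoint (fibre f i) (fibre f j) := by
  rw [Finset.disjoint_left]
  intro p h1 h2
  simp only [fibre, Finset.mem_filter, Finset.mem_univ, true_and] at h1 h2
  exact h (h1.symm.trans h2)

/-- Operadic substitution `Lie(g⁻¹(k)) → Lie((g ∘ f)⁻¹(k))` of the elements `a_j ∈ Lie(f⁻¹(j))`. -/
def substFibre {m n t : ℕ} (f : Surj m n) (g : Surj n t)
    (a : ∀ j, (LieOn (fibre f.1 j) : Submodule ℚ (FreeLie m))) (k : Fin t) :
    (LieOn (fibre g.1 k) : Submodule ℚ (FreeLie n)) →ₗ[ℚ]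
      (LieOn (fibre (g.comp f).1 k) : Submodule ℚ (FreeLie m)) :=
  LinearMap.restrict (subst fun j => (a j : FreeLie m) : FreeLie n →ₗ[ℚ] FreeLie m)
    fun _ hc => fibre_comp g f k ▸ subst_mem (fibre_disjoint f.1) (fun j _ => (a j).2) hc

theorem coe_substFibre {m n t : ℕ} (f : Surj m n) (g : Surj n t)
    (a : ∀ j, (LieOn (fibre f.1 j) : Submodule ℚ (FreeLie m))) (k : Fin t)
    (c : (LieOn (fibre g.1 k) : Submodule ℚ (FreeLie n))) :
    (substFibre f g a k c : FreeLie m) = subst (fun j => (a j : FreeLie m)) (c : FreeLie n) := rfl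

theorem coe_update {m n : ℕ} {T : Fin n → Finset (Fin m)}
    (a : ∀ j, (LieOn (T j) : Submodule ℚ (FreeLie m))) (j : Fin n) (x) :
    (fun i => (Function.update a j x i : FreeLie m)) =
      Function.update (fun i => (a i : FreeLie m)) j (x : FreeLie m) := by
  funext i
  rcases eq_or_ne i j with rfl | h
  · simp
  · simp [h]

theorem substFibre_update {m n t : ℕ} (f : Surj m n) (g : Surj n t)
    (a : ∀ j, (LieOn (fibre f.1 j) : Submodule ℚ (FreeLie m))) (j : Fin n) (x) :
    substFibre f g (Function.update a j x) = Function.update (substFibre f g a) (g.1 j)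
      (substFibre f g (Function.update a j x) (g.1 j)) := by
  funext k
  rcases eq_or_ne k (g.1 j) with rfl | h
  · simp
  · rw [Function.update_of_ne h]
    ext c
    rw [coe_substFibre, coe_substFibre, coe_update,
      subst_update_of_notMem _ (by simpa [fibre] using h.symm) _ c.2]

/-- The tensor product over `k` of the substitution maps, as a multilinear function of the `a_j`. -/
def compSummandMultilinear {m n t : ℕ} (f : Surj m n) (g : Surj n t) :
    MultilinearMap ℚ (fun j => (LieOn (fibre f.1 j) : Submodule ℚ (FreeLie m)))
      (CatLieSummand g →ₗ[ℚ] CatLieSummand (g.comp f)) :=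
  MultilinearMap.mk' (fun a => PiTensorProduct.map (substFibre f g a))
    (fun a j x y => by
      have h : substFibre f g (Function.update a j (x + y)) (g.1 j) =
          substFibre f g (Function.update a j x) (g.1 j) +
            substFibre f g (Function.update a j y) (g.1 j) := by
        ext c
        simp only [LinearMap.add_apply, Submodule.coe_add, coe_substFibre, coe_update]
        exact subst_update_add _ (by simp [fibre]) _ _ c.2
      rw [substFibre_update, h, PiTensorProduct.map_update_add, ← substFibre_update,
        ← substFibre_update])
    (fun a j r x => by
      have h : substFibre f g (Function.update a j (r • x)) (g.1 j) =
          r • substFibre f g (Function.update a j x) (g.1 j) := by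
        ext c
        simp only [LinearMap.smul_apply, Submodule.coe_smul, coe_substFibre, coe_update]
        exact subst_update_smul _ (by simp [fibre]) _ _ c.2
      rw [substFibre_update, h, PiTensorProduct.map_update_smul, ← substFibre_update])

/-- Composition of the summand of index `f` with the summand of index `g`. -/
def compSummand {m n t : ℕ} (f : Surj m n) (g : Surj n t) :
    CatLieSummand f →ₗ[ℚ] CatLieSummand g →ₗ[ℚ] CatLieSummand (g.comp f) :=
  PiTensorProduct.lift (compSummandMultilinear f g)

/-- Composition in `CatLie`, in diagrammatic order. -/
def comp {m n t : ℕ} : CatLieHom m n →ₗ[ℚ] CatLieHom n t →ₗ[ℚ] CatLieHom m t :=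
  homLift fun f => LinearMap.flip <| homLift fun g =>
    LinearMap.flip <| (compSummand f g).compr₂ (incl (g.comp f))

/-- The elementary morphism of index `f` and components `a_i`. -/
def pureHom {m n : ℕ} (f : Surj m n)
    (a : ∀ i, (LieOn (fibre f.1 i) : Submodule ℚ (FreeLie m))) : CatLieHom m n :=
  incl f (PiTensorProduct.tprod ℚ a)

theorem comp_pure {m n t : ℕ} (f : Surj m n) (g : Surj n t)
    (a : ∀ i, (LieOn (fibre f.1 i) : Submodule ℚ (FreeLie m)))
    (b : ∀ i, (LieOn (fibre g.1 i) : Submodule ℚ (FreeLie n))) :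
    comp (pureHom f a) (pureHom g b) = pureHom (g.comp f) (fun k => substFibre f g a k (b k)) := by
  have h : compSummand f g (PiTensorProduct.tprod ℚ a) (PiTensorProduct.tprod ℚ b) =
      PiTensorProduct.tprod ℚ fun k => substFibre f g a k (b k) := by
    rw [compSummand, PiTensorProduct.lift.tprod]
    exact PiTensorProduct.map_tprod _ _
  rw [comp, pureHom, pureHom, homLift_incl, LinearMap.flip_apply, homLift_incl,
    LinearMap.flip_apply, LinearMap.compr₂_apply, h]
  rfl

theorem hom_ext {m n : ℕ} {E : Type} [AddCommGroup E] [Module ℚ E]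
    {φ ψ : CatLieHom m n →ₗ[ℚ] E} (h : ∀ f a, φ (pureHom f a) = ψ (pureHom f a)) : φ = ψ :=
  DirectSum.linearMap_ext (M := fun h : Surj m n => CatLieSummand h) ℚ
    fun f => PiTensorProduct.ext (MultilinearMap.ext fun a => h f a)

theorem hom_induction {m n : ℕ} {p : CatLieHom m n → Prop} (hpure : ∀ f a, p (pureHom f a))
    (zero : p 0) (add : ∀ x y, p x → p y → p (x + y)) (smul : ∀ (r : ℚ) x, p x → p (r • x))
    (x : CatLieHom m n) : p x := by
  let W : Submodule ℚ (CatLieHom m n) :=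
    { carrier := {x | p x}, zero_mem' := zero, add_mem' := add _ _, smul_mem' := smul }
  have : W.mkQ = 0 := hom_ext (φ := W.mkQ) (ψ := 0) fun f a => (Submodule.Quotient.mk_eq_zero W).2 (hpure f a)
  exact (Submodule.Quotient.mk_eq_zero W).1 (LinearMap.congr_fun this x)

/-- The identity: index `id`, components the generators `x_i ∈ Lie({i})`. -/
def idHom (n : ℕ) : CatLieHom n n :=
  pureHom ⟨id, Function.surjective_id⟩ fun i =>
    ⟨FreeLieAlgebra.of ℚ i, by
      have : fibre id i = {i} := by ext; simp [fibre]
      rw [this]; exact of_mem_LieOn i⟩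

theorem pure_congr {m n : ℕ} {f f' : Surj m n} (h : f.1 = f'.1) {a a'}
    (ha : ∀ i, (a i : FreeLie m) = a' i) : pureHom f a = pureHom f' a' := by
  obtain rfl : f = f' := Subtype.ext h
  congr 1
  funext i
  exact Subtype.ext (ha i)

theorem id_comp {m n : ℕ} (x : CatLieHom m n) : comp (idHom m) x = x := by
  have : comp (idHom m) = (LinearMap.id : CatLieHom m n →ₗ[ℚ] _) := hom_ext fun f a => by
    rw [idHom, comp_pure, LinearMap.id_apply]
    exact pure_congr rfl fun i => by rw [coe_substFibre]; exact subst_of_self _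
  rw [this]; rfl

theorem comp_id {m n : ℕ} (x : CatLieHom m n) : comp x (idHom n) = x := by
  have : comp.flip (idHom n) = (LinearMap.id : CatLieHom m n →ₗ[ℚ] _) := hom_ext fun f a => by
    rw [idHom, LinearMap.flip_apply, comp_pure, LinearMap.id_apply]
    exact pure_congr rfl fun i => by rw [coe_substFibre]; exact subst_of _ _
  exact congrArg (fun φ => φ x) this

theorem comp_assoc {l m n t : ℕ} (x : CatLieHom l m) (y : CatLieHom m n) (z : CatLieHom n t) :
    comp (comp x y) z = comp x (comp y z) := by
  induction x using hom_induction with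
  | zero => simp only [map_zero, LinearMap.zero_apply]
  | add x x' h h' => simp only [map_add, LinearMap.add_apply, h, h']
  | smul r x h => simp only [map_smul, LinearMap.smul_apply, h]
  | hpure f a =>
  induction y using hom_induction with
  | zero => simp only [map_zero, LinearMap.zero_apply]
  | add x x' h h' => simp only [map_add, LinearMap.add_apply, h, h']
  | smul r x h => simp only [map_smul, LinearMap.smul_apply, h]
  | hpure g b =>
  induction z using hom_induction with
  | zero => simp only [map_zero]
  | add x x' h h' => simp only [map_add, h, h']
  | smul r x h => simp only [map_smul, h]
  | hpure h c =>
  rw [comp_pure, comp_pure, comp_pure, comp_pure]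
  exact pure_congr rfl fun k => by
    simp only [coe_substFibre]
    exact (subst_subst _ _ _).symm


/-! ### The functor `- ⊞ 1` on morphisms -/

/-- The surjection `f ⊞ 1`: it is `f` on `{0, …, m-1}`, and the last element is sent to the last
element. -/
def Surj.shift {m n : ℕ} (f : Surj m n) : Surj (m + 1) (n + 1) :=
  ⟨Fin.snoc (α := fun _ => Fin (n + 1)) (fun p => (f.1 p).castSucc) (Fin.last n), fun j => by
    induction j using Fin.lastCases with
    | last => exact ⟨Fin.last m, by simp⟩
    | cast j =>
      obtain ⟨p, hp⟩ := f.2 j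
      exact ⟨p.castSucc, by simp [hp]⟩⟩

@[simp] theorem Surj.shift_castSucc {m n : ℕ} (f : Surj m n) (p : Fin m) :
    f.shift.1 p.castSucc = (f.1 p).castSucc := by
  simp [Surj.shift]

@[simp] theorem Surj.shift_last {m n : ℕ} (f : Surj m n) :
    f.shift.1 (Fin.last m) = Fin.last n := by
  simp [Surj.shift]

/-- The inclusion of the free Lie algebra on `x_0, …, x_{m-1}` in the one on `x_0, …, x_m`. -/
def weaken {m : ℕ} : FreeLie m →ₗ⁅ℚ⁆ FreeLie (m + 1) :=
  subst fun i => FreeLieAlgebra.of ℚ i.castSucc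

theorem weaken_mem {m n : ℕ} (f : Surj m n) (i : Fin n) {c : FreeLie m}
    (hc : c ∈ LieOn (fibre f.1 i)) : weaken c ∈ LieOn (fibre f.shift.1 i.castSucc) := by
  have h : (fibre f.1 i).biUnion (fun p => {p.castSucc}) = fibre f.shift.1 i.castSucc := by
    ext p
    induction p using Fin.lastCases with
    | last => simp [mem_fibre, (Fin.castSucc_ne_last _).symm]
    | cast p => simp [mem_fibre]
  rw [← h]
  exact subst_mem (T := fun p => {p.castSucc})
    (fun i j h => by simpa using h) (fun i _ => of_mem_LieOn _) hc

theorem of_last_mem {m n : ℕ} (f : Surj m n) :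
    FreeLieAlgebra.of ℚ (Fin.last m) ∈ LieOn (fibre f.shift.1 (Fin.last n)) := by
  have h : fibre f.shift.1 (Fin.last n) = {Fin.last m} := by
    ext p
    induction p using Fin.lastCases with
    | last => simp [mem_fibre]
    | cast p => simp [mem_fibre, Fin.castSucc_ne_last]
  rw [h]
  exact of_mem_LieOn _

/-- `weaken` on the component of index `i`. -/
def weakenFibre {m n : ℕ} (f : Surj m n) (i : Fin n) :
    (LieOn (fibre f.1 i) : Submodule ℚ (FreeLie m)) →ₗ[ℚ]
      (LieOn (fibre f.shift.1 i.castSucc) : Submodule ℚ (FreeLie (m + 1))) :=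
  LinearMap.restrict (p := LieOn (fibre f.1 i)) (q := LieOn (fibre f.shift.1 i.castSucc))
    (weaken (m := m) : FreeLie m →ₗ[ℚ] FreeLie (m + 1)) fun _ hc => weaken_mem f i hc

/-- The components of `φ ⊞ 1`, for `φ` the elementary morphism of index `f` and components `a_i`:
the `a_i`, and the unit `x_m ∈ Lie({m})` in the last place. -/
def shiftComponents {m n : ℕ} (f : Surj m n)
    (a : ∀ i, (LieOn (fibre f.1 i) : Submodule ℚ (FreeLie m))) :
    ∀ i, (LieOn (fibre f.shift.1 i) : Submodule ℚ (FreeLie (m + 1))) :=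
  Fin.snoc (α := fun i => (LieOn (fibre f.shift.1 i) : Submodule ℚ (FreeLie (m + 1))))
    (fun i => weakenFibre f i (a i)) ⟨FreeLieAlgebra.of ℚ (Fin.last m), of_last_mem f⟩

theorem shiftComponents_update {m n : ℕ} (f : Surj m n)
    (a : ∀ i, (LieOn (fibre f.1 i) : Submodule ℚ (FreeLie m))) (i : Fin n) (x) :
    shiftComponents f (Function.update a i x) =
      Function.update (shiftComponents f a) i.castSucc (weakenFibre f i x) := by
  rw [shiftComponents, shiftComponents, ← Fin.snoc_update]
  congr 1
  funext j
  rcases eq_or_ne j i with rfl | h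
  · simp
  · simp [h]

/-- `φ ↦ φ ⊞ 1` on the summand of index `f`. -/
def shiftSummand {m n : ℕ} (f : Surj m n) : CatLieSummand f →ₗ[ℚ] CatLieSummand f.shift :=
  PiTensorProduct.lift <| MultilinearMap.mk'
    (fun a => PiTensorProduct.tprod ℚ (shiftComponents f a))
    (fun a i x y => by
      simp only [shiftComponents_update, map_add, MultilinearMap.map_update_add])
    (fun a i r x => by
      simp only [shiftComponents_update, map_smul, MultilinearMap.map_update_smul])

/-- `φ ↦ φ ⊞ 1` on morphisms of `CatLie`. -/
def shift {m n : ℕ} : CatLieHom m n →ₗ[ℚ] CatLieHom (m + 1) (n + 1) :=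
  homLift fun f => (incl f.shift).comp (shiftSummand f)

theorem shift_pure {m n : ℕ} (f : Surj m n) (a) :
    shift (pureHom f a) = pureHom f.shift (shiftComponents f a) := by
  rw [shift, pureHom, homLift_incl, LinearMap.comp_apply, shiftSummand, PiTensorProduct.lift.tprod]
  rfl

theorem coe_shiftComponents_castSucc {m n : ℕ} (f : Surj m n) (a) (i : Fin n) :
    (shiftComponents f a i.castSucc : FreeLie (m + 1)) = weaken (a i : FreeLie m) := by
  rw [shiftComponents, Fin.snoc_castSucc]
  rfl

theorem coe_shiftComponents_last {m n : ℕ} (f : Surj m n) (a) :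
    (shiftComponents f a (Fin.last n) : FreeLie (m + 1)) = FreeLieAlgebra.of ℚ (Fin.last m) := by
  simp [shiftComponents]

theorem shift_id (n : ℕ) : shift (idHom n) = idHom (n + 1) := by
  rw [idHom, shift_pure]
  refine pure_congr ?_ fun i => ?_
  · funext p
    induction p using Fin.lastCases <;> simp
  · induction i using Fin.lastCases with
    | last => rw [coe_shiftComponents_last]
    | cast i =>
      rw [coe_shiftComponents_castSucc]
      exact subst_of _ _

theorem shift_comp {m n t : ℕ} (x : CatLieHom m n) (y : CatLieHom n t) :
    shift (comp x y) = comp (shift x) (shift y) := by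
  induction x using hom_induction with
  | zero => simp only [map_zero, LinearMap.zero_apply]
  | add x x' h h' => simp only [map_add, LinearMap.add_apply, h, h']
  | smul r x h => simp only [map_smul, LinearMap.smul_apply, h]
  | hpure f a =>
  induction y using hom_induction with
  | zero => simp only [map_zero]
  | add x x' h h' => simp only [map_add, h, h']
  | smul r x h => simp only [map_smul, h]
  | hpure g b =>
  rw [comp_pure, shift_pure, shift_pure, shift_pure, comp_pure]
  refine pure_congr ?_ fun k => ?_
  · funext p
    induction p using Fin.lastCases <;> simp [Surj.comp]
  · rw [coe_substFibre]
    induction k using Fin.lastCases with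
    | last => rw [coe_shiftComponents_last, coe_shiftComponents_last, subst_of,
        coe_shiftComponents_last]
    | cast k =>
      rw [coe_shiftComponents_castSucc, coe_shiftComponents_castSucc, coe_substFibre, weaken,
        weaken, subst_subst, subst_subst]
      congr 2
      funext i
      rw [subst_of, coe_shiftComponents_castSucc, weaken]

/-! ### The elements `μ(n)` and the complex -/

/-- The surjection `{0, …, n} → {0, …, n-1}` that is the identity on `{0, …, n-1}` and sends the
last element to `i`. -/
def merge {n : ℕ} (i : Fin n) : Surj (n + 1) n :=
  ⟨Fin.snoc (α := fun _ => Fin n) id i, fun j => ⟨j.castSucc, by simp⟩⟩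

@[simp] theorem merge_castSucc {n : ℕ} (i j : Fin n) : (merge i).1 j.castSucc = j := by
  simp [merge]

@[simp] theorem merge_last {n : ℕ} (i : Fin n) : (merge i).1 (Fin.last n) = i := by
  simp [merge]

/-- The components of the generator of index `merge i`: the bracket `[x_i, x_n]` in the component
`i`, and `x_j` in every other component `j`. -/
def muGen {n : ℕ} (i : Fin n) : Fin n → FreeLie (n + 1) :=
  Function.update (fun j => FreeLieAlgebra.of ℚ j.castSucc) i
    ⁅FreeLieAlgebra.of ℚ i.castSucc, FreeLieAlgebra.of ℚ (Fin.last n)⁆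

theorem muGen_mem {n : ℕ} (i j : Fin n) : muGen i j ∈ LieOn (fibre (merge i).1 j) := by
  rcases eq_or_ne j i with rfl | h
  · have : fibre (merge j).1 j = {j.castSucc} ∪ {Fin.last n} := by
      ext p
      induction p using Fin.lastCases <;> simp [mem_fibre]
    rw [this, muGen, Function.update_self]
    exact lie_mem_LieOn (by simp) (of_mem_LieOn _) (of_mem_LieOn _)
  · have : fibre (merge i).1 j = {j.castSucc} := by
      ext p
      induction p using Fin.lastCases with
      | last => simp [mem_fibre, h.symm, (Fin.castSucc_ne_last j).symm]
      | cast p => simp [mem_fibre]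
    rw [this, muGen, Function.update_of_ne h]
    exact of_mem_LieOn _

/-- `μ(n) ∈ CatLie(n+1, n)`: the sum, over the surjections `f : {0, …, n} → {0, …, n-1}` that are
the identity on `{0, …, n-1}`, of the canonical generators of the summands of index `f`. -/
def mu (n : ℕ) : CatLieHom (n + 1) n :=
  ∑ i : Fin n, pureHom (merge i) fun j => ⟨muGen i j, muGen_mem i j⟩

/-- `μ̃ : δCatLie(m, n) = CatLie(m, n+1) → CatLie(m, n)`, postcomposition with `μ(n)`. -/
def muTilde (m n : ℕ) : CatLieHom m (n + 1) →ₗ[ℚ] CatLieHom m n :=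
  comp.flip (mu n)

/-- The component of index `f`. -/
def coeff {m n : ℕ} (f : Surj m n) : CatLieHom m n →ₗ[ℚ] CatLieSummand f :=
  DirectSum.component ℚ (Surj m n) (fun h => CatLieSummand h) f

/-- `δ⁽¹⁾CatLie(m, n) ⊆ δCatLie(m, n) = CatLie(m, n+1)`: the sum of the summands indexed by the
surjections whose fibre over the last element has cardinality one. -/
def delta1 (m n : ℕ) : Submodule ℚ (CatLieHom m (n + 1)) :=
  ⨅ f : Surj m (n + 1), ⨅ _ : (fibre f.1 (Fin.last n)).card ≠ 1, LinearMap.ker (coeff f)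

/-- The differential `μ̃⁽¹⁾ : δ⁽¹⁾CatLie(m, n) → CatLie(m, n)`, the restriction of `μ̃`. -/
def muTilde1 (m n : ℕ) : delta1 m n →ₗ[ℚ] CatLieHom m n :=
  (muTilde m n).domRestrict (delta1 m n)

/-! ### The image of the differential is a two-sided ideal -/

theorem coeff_pure_of_ne {m n : ℕ} {f g : Surj m n} (h : f ≠ g) (a) :
    coeff g (pureHom f a) = 0 :=
  DirectSum.of_eq_of_ne _ _ _ h.symm

theorem pure_mem_delta1 {m n : ℕ} (f : Surj m (n + 1)) (a)
    (h : (fibre f.1 (Fin.last n)).card = 1) : pureHom f a ∈ delta1 m n := by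
  simp only [delta1, Submodule.mem_iInf, LinearMap.mem_ker]
  intro g hg
  refine coeff_pure_of_ne ?_ a
  rintro rfl
  exact hg h

/-- The `a_i` are the components of an elementary morphism of index `f`. -/
def Valid {m n : ℕ} (f : Fin m → Fin n) (a : Fin n → FreeLie m) : Prop :=
  Function.Surjective f ∧ ∀ i, a i ∈ LieOn (fibre f i)

open Classical in
/-- The elementary morphism of index `f` and components `a_i` (zero if these are not valid). -/
def mk {m n : ℕ} (f : Fin m → Fin n) (a : Fin n → FreeLie m) : CatLieHom m n :=
  if h : Valid f a then pureHom ⟨f, h.1⟩ fun i => ⟨a i, h.2 i⟩ else 0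

theorem mk_of_valid {m n : ℕ} {f : Fin m → Fin n} {a : Fin n → FreeLie m} (h : Valid f a) :
    mk f a = pureHom ⟨f, h.1⟩ fun i => ⟨a i, h.2 i⟩ :=
  dif_pos h

theorem pure_eq_mk {m n : ℕ} (f : Surj m n) (a) :
    pureHom f a = mk f.1 fun i => (a i : FreeLie m) := by
  rw [mk_of_valid ⟨f.2, fun i => (a i).2⟩]

theorem valid_comp {m n t : ℕ} {f : Fin m → Fin n} {a : Fin n → FreeLie m} (h : Valid f a)
    {g : Fin n → Fin t} {b : Fin t → FreeLie n} (h' : Valid g b) :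
    Valid (g ∘ f) fun k => subst a (b k) :=
  ⟨h'.1.comp h.1, fun k =>
    (substFibre ⟨f, h.1⟩ ⟨g, h'.1⟩ (fun j => ⟨a j, h.2 j⟩) k ⟨b k, h'.2 k⟩).2⟩

theorem comp_mk {m n t : ℕ} {f : Fin m → Fin n} {a : Fin n → FreeLie m} (h : Valid f a)
    {g : Fin n → Fin t} {b : Fin t → FreeLie n} (h' : Valid g b) :
    comp (mk f a) (mk g b) = mk (g ∘ f) fun k => subst a (b k) := by
  rw [mk_of_valid h, mk_of_valid h', mk_of_valid (valid_comp h h'), comp_pure]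
  rfl

theorem muGen_valid {n : ℕ} (i : Fin n) : Valid (merge i).1 (muGen i) :=
  ⟨(merge i).2, muGen_mem i⟩

theorem subst_muGen {m n : ℕ} (a : Fin (n + 1) → FreeLie m) (i : Fin n) :
    (fun k => subst a (muGen i k)) =
      Function.update (fun j => a j.castSucc) i ⁅a i.castSucc, a (Fin.last n)⁆ := by
  funext k
  rcases eq_or_ne k i with rfl | h
  · simp [muGen, LieHom.map_lie]
  · simp [muGen, h]

theorem mu_eq (n : ℕ) : mu n = ∑ i : Fin n, mk (merge i).1 (muGen i) :=
  Finset.sum_congr rfl fun _ _ => pure_eq_mk _ _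

theorem valid_snoc {m n : ℕ} {f : Fin m → Fin (n + 1)} {a : Fin n → FreeLie m} {c : FreeLie m}
    (hf : Function.Surjective f) (ha : ∀ i, a i ∈ LieOn (fibre f i.castSucc))
    (hc : c ∈ LieOn (fibre f (Fin.last n))) :
    Valid f (Fin.snoc (α := fun _ => FreeLie m) a c) := by
  refine ⟨hf, fun i => ?_⟩
  induction i using Fin.lastCases with
  | last => simpa using hc
  | cast i => simpa using ha i

theorem muTilde_mk {m n : ℕ} {f : Fin m → Fin (n + 1)} {a : Fin n → FreeLie m} {c : FreeLie m}
    (hf : Function.Surjective f) (ha : ∀ i, a i ∈ LieOn (fibre f i.castSucc))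
    (hc : c ∈ LieOn (fibre f (Fin.last n))) :
    muTilde m n (mk f (Fin.snoc (α := fun _ => FreeLie m) a c)) =
      ∑ i : Fin n, mk ((merge i).1 ∘ f) (Function.update a i ⁅a i, c⁆) := by
  rw [muTilde, LinearMap.flip_apply, mu_eq, map_sum]
  refine Finset.sum_congr rfl fun i _ => ?_
  rw [comp_mk (valid_snoc hf ha hc) (muGen_valid i), subst_muGen]
  simp

/-- The components `a`, with the component `k` replaced by `0`. -/
def punctured {m n : ℕ} (f : Fin m → Fin n) (a : Fin n → FreeLie m) (k : Fin n)
    (ha : ∀ j, j ≠ k → a j ∈ LieOn (fibre f j)) (j : Fin n) :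
    (LieOn (fibre f j) : Submodule ℚ (FreeLie m)) :=
  if h : j = k then 0 else ⟨a j, ha j h⟩

/-- `mk f a` as a linear function of the component `a k`. -/
def mkLin {m n : ℕ} (f : Fin m → Fin n) (a : Fin n → FreeLie m) (k : Fin n)
    (hf : Function.Surjective f) (ha : ∀ j, j ≠ k → a j ∈ LieOn (fibre f j)) :
    (LieOn (fibre f k) : Submodule ℚ (FreeLie m)) →ₗ[ℚ] CatLieHom m n :=
  (incl ⟨f, hf⟩).comp <| (PiTensorProduct.tprod ℚ).toLinearMap (punctured f a k ha) k

theorem mkLin_apply {m n : ℕ} (f : Fin m → Fin n) (a : Fin n → FreeLie m) (k : Fin n)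
    (hf : Function.Surjective f) (ha : ∀ j, j ≠ k → a j ∈ LieOn (fibre f j))
    (z : (LieOn (fibre f k) : Submodule ℚ (FreeLie m))) :
    mkLin f a k hf ha z = mk f (Function.update a k (z : FreeLie m)) := by
  have h₁ : mkLin f a k hf ha z = pureHom ⟨f, hf⟩ (Function.update (punctured f a k ha) k z) := rfl
  rw [h₁, pure_eq_mk]
  congr 1
  funext j
  rcases eq_or_ne j k with rfl | h
  · simp
  · simp [h, punctured]

theorem muTilde_mem_aux {m n : ℕ} {S : Finset (Fin m)} {c : FreeLie m} (hc : c ∈ LieOn S) :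
    ∀ (f : Fin m → Fin (n + 1)) (a : Fin n → FreeLie m), Function.Surjective f →
      (∀ i, a i ∈ LieOn (fibre f i.castSucc)) → fibre f (Fin.last n) = S →
      muTilde m n (mk f (Fin.snoc (α := fun _ => FreeLie m) a c)) ∈
        LinearMap.range (muTilde1 m n) := by
  have hlin : ∀ (f : Fin m → Fin (n + 1)) (a : Fin n → FreeLie m), Function.Surjective f →
      (∀ i, a i ∈ LieOn (fibre f i.castSucc)) →
      ∃ φ : (LieOn (fibre f (Fin.last n)) : Submodule ℚ (FreeLie m)) →ₗ[ℚ] CatLieHom m n,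
        ∀ z, φ z = muTilde m n (mk f (Fin.snoc (α := fun _ => FreeLie m) a (z : FreeLie m))) := by
    intro f a hf ha
    refine ⟨(muTilde m n).comp (mkLin f (Fin.snoc (α := fun _ => FreeLie m) a 0) (Fin.last n) hf
      fun j _ => (valid_snoc hf ha (zero_mem _)).2 j), fun z => ?_⟩
    rw [LinearMap.comp_apply, mkLin_apply, Fin.update_snoc_last]
  refine LieOn_induction (p := fun S c => ∀ (f : Fin m → Fin (n + 1)) (a : Fin n → FreeLie m),
      Function.Surjective f → (∀ i, a i ∈ LieOn (fibre f i.castSucc)) → fibre f (Fin.last n) = S →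
      muTilde m n (mk f (Fin.snoc (α := fun _ => FreeLie m) a c)) ∈
        LinearMap.range (muTilde1 m n)) ?_ ?_ ?_ ?_ ?_ hc
  · intro p f a hf ha hS
    refine ⟨⟨mk f (Fin.snoc (α := fun _ => FreeLie m) a (FreeLieAlgebra.of ℚ p)), ?_⟩, rfl⟩
    rw [mk_of_valid (valid_snoc hf ha (hS ▸ of_mem_LieOn p))]
    exact pure_mem_delta1 _ _ (by simp [hS])
  · intro S₁ S₂ c₁ c₂ hn₁ hn₂ hd hc₁ hc₂ ih₁ ih₂ f a hf ha hS
    have hlast : ∀ p, f p = Fin.last n ↔ p ∈ S₁ ∨ p ∈ S₂ := fun p => by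
      rw [← mem_fibre, hS, Finset.mem_union]
    -- moving a part `T` of the fibre over the last element to the fibre over `i`
    let mv : Finset (Fin m) → Fin n → Fin m → Fin (n + 1) := fun T i p =>
      if p ∈ T then i.castSucc else f p
    have key : ∀ (T U : Finset (Fin m)) (d e : FreeLie m), Disjoint T U → U.Nonempty →
        (∀ p, f p = Fin.last n ↔ p ∈ T ∨ p ∈ U) → d ∈ LieOn T → e ∈ LieOn U →
        (∀ (f : Fin m → Fin (n + 1)) (a : Fin n → FreeLie m), Function.Surjective f →
          (∀ i, a i ∈ LieOn (fibre f i.castSucc)) → fibre f (Fin.last n) = U →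
          muTilde m n (mk f (Fin.snoc (α := fun _ => FreeLie m) a e)) ∈
          LinearMap.range (muTilde1 m n)) →
        ∀ i, ∑ j, mk ((merge j).1 ∘ mv T i) (Function.update (Function.update a i ⁅a i, d⁆) j
            ⁅Function.update a i ⁅a i, d⁆ j, e⁆) ∈ LinearMap.range (muTilde1 m n) ∧
          ⁅⁅a i, d⁆, e⁆ ∈ LieOn (fibre ((merge i).1 ∘ f) i) := by
      intro T U d e hTU hU hTU' hd he ih i
      have hsurj : Function.Surjective (mv T i) := by
        intro j
        induction j using Fin.lastCases with
        | last =>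
          obtain ⟨p, hp⟩ := hU
          exact ⟨p, by simp [mv, Finset.disjoint_right.1 hTU hp, (hTU' p).2 (.inr hp)]⟩
        | cast j =>
          obtain ⟨p, hp⟩ := hf j.castSucc
          have : p ∉ T := fun h => by
            have := (hTU' p).2 (.inl h)
            rw [hp] at this
            exact absurd this (Fin.castSucc_ne_last j)
          exact ⟨p, by simp [mv, this, hp]⟩
      have hfl : fibre (mv T i) (Fin.last n) = U := by
        ext p
        rw [mem_fibre]
        by_cases h : p ∈ T
        · simp [mv, h, Finset.disjoint_left.1 hTU h, Fin.castSucc_ne_last]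
        · simp [mv, h, hTU' p]
      have hfi : fibre (mv T i) i.castSucc = fibre f i.castSucc ∪ T := by
        ext p
        rw [mem_fibre, Finset.mem_union, mem_fibre]
        by_cases h : p ∈ T <;> simp [mv, h]
      have hfj : ∀ j, j ≠ i → fibre (mv T i) j.castSucc = fibre f j.castSucc := by
        intro j hj
        ext p
        rw [mem_fibre, mem_fibre]
        by_cases h : p ∈ T
        · simp [mv, h, hj.symm, (hTU' p).2 (.inl h), (Fin.castSucc_ne_last j).symm]
        · simp [mv, h]
      have hdis : Disjoint (fibre f i.castSucc) (T ∪ U) := by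
        rw [Finset.disjoint_left]
        intro p hp hp'
        rw [mem_fibre] at hp
        have := (hTU' p).2 (Finset.mem_union.1 hp')
        rw [hp] at this
        exact absurd this (Fin.castSucc_ne_last i)
      have hai : ⁅a i, d⁆ ∈ LieOn (fibre f i.castSucc ∪ T) :=
        lie_mem_LieOn (hdis.mono_right Finset.subset_union_left) (ha i) hd
      constructor
      · have ha' : ∀ j, Function.update a i ⁅a i, d⁆ j ∈ LieOn (fibre (mv T i) j.castSucc) := by
          intro j
          rcases eq_or_ne j i with rfl | h
          · rw [hfi, Function.update_self]; exact hai
          · rw [hfj j h, Function.update_of_ne h]; exact ha j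
        rw [← muTilde_mk hsurj ha' (hfl ▸ he)]
        exact ih _ _ hsurj ha' hfl
      · have : fibre ((merge i).1 ∘ f) i = (fibre f i.castSucc ∪ T) ∪ U := by
          ext p
          rw [mem_fibre, Finset.union_assoc, Finset.mem_union, Finset.mem_union, ← hTU' p,
            mem_fibre, Function.comp_apply]
          generalize f p = q
          induction q using Fin.lastCases with
          | last => simp
          | cast q => simp [Fin.castSucc_ne_last]
        rw [this]
        refine lie_mem_LieOn ?_ hai he
        rw [Finset.disjoint_union_left]
        exact ⟨hdis.mono_right Finset.subset_union_right, hTU⟩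
    have hc : ⁅c₁, c₂⁆ ∈ LieOn (fibre f (Fin.last n)) := hS ▸ lie_mem_LieOn hd hc₁ hc₂
    have k₁ := key S₁ S₂ c₁ c₂ hd hn₂ hlast hc₁ hc₂ ih₂
    have k₂ := key S₂ S₁ c₂ c₁ hd.symm hn₁ (fun p => (hlast p).trans or_comm) hc₂ hc₁ ih₁
    set X : Fin n → Fin n → CatLieHom m n := fun i j => mk ((merge j).1 ∘ mv S₁ i)
      (Function.update (Function.update a i ⁅a i, c₁⁆) j ⁅Function.update a i ⁅a i, c₁⁆ j, c₂⁆)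
      with hX
    set Y : Fin n → Fin n → CatLieHom m n := fun i j => mk ((merge j).1 ∘ mv S₂ i)
      (Function.update (Function.update a i ⁅a i, c₂⁆) j ⁅Function.update a i ⁅a i, c₂⁆ j, c₁⁆)
      with hY
    have hfun : ∀ i j, (merge j).1 ∘ mv S₁ i = (merge i).1 ∘ mv S₂ j := by
      intro i j
      funext p
      by_cases h₁ : p ∈ S₁
      · have h₂ := Finset.disjoint_left.1 hd h₁
        simp [mv, h₁, h₂, (hlast p).2 (.inl h₁)]
      · by_cases h₂ : p ∈ S₂
        · simp [mv, h₁, h₂, (hlast p).2 (.inr h₂)]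
        · have h := mt (hlast p).1 (not_or.2 ⟨h₁, h₂⟩)
          simp only [mv, h₁, h₂, Function.comp_apply, if_false]
          obtain ⟨q, hq⟩ := Fin.exists_castSucc_eq.2 h
          rw [← hq, merge_castSucc, merge_castSucc]
    have hfun' : ∀ i, (merge i).1 ∘ mv S₁ i = (merge i).1 ∘ f := by
      intro i
      funext p
      by_cases h₁ : p ∈ S₁
      · simp [mv, h₁, (hlast p).2 (.inl h₁)]
      · simp [mv, h₁]
    have hXY : ∀ i j, j ≠ i → X i j = Y j i := by
      intro i j h
      simp only [hX, hY]
      rw [hfun, Function.update_of_ne h, Function.update_of_ne h.symm, Function.update_comm h]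
    have hXX : ∀ i, X i i - Y i i =
        mk ((merge i).1 ∘ f) (Function.update a i ⁅a i, ⁅c₁, c₂⁆⁆) := by
      intro i
      simp only [hX, hY]
      rw [← hfun i i, hfun' i, Function.update_self, Function.update_self, Function.update_idem,
        Function.update_idem]
      have hs : Function.Surjective ((merge i).1 ∘ f) := (merge i).2.comp hf
      have ha' : ∀ j, j ≠ i → a j ∈ LieOn (fibre ((merge i).1 ∘ f) j) := by
        intro j hj
        have : fibre ((merge i).1 ∘ f) j = fibre f j.castSucc := by
          ext p
          rw [mem_fibre, mem_fibre, Function.comp_apply]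
          generalize f p = q
          induction q using Fin.lastCases with
          | last => simp [hj.symm, (Fin.castSucc_ne_last j).symm]
          | cast q => simp
        rw [this]
        exact ha j
      have e₁ := mkLin_apply ((merge i).1 ∘ f) a i hs ha' ⟨_, (k₁ i).2⟩
      have e₂ := mkLin_apply ((merge i).1 ∘ f) a i hs ha' ⟨_, (k₂ i).2⟩
      have e₃ := mkLin_apply ((merge i).1 ∘ f) a i hs ha' (⟨_, (k₁ i).2⟩ - ⟨_, (k₂ i).2⟩)
      rw [map_sub, e₁, e₂] at e₃
      refine e₃.trans ?_
      congr 2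
      change ⁅⁅a i, c₁⁆, c₂⁆ - ⁅⁅a i, c₂⁆, c₁⁆ = _
      rw [leibniz_lie (a i) c₁ c₂, ← lie_skew c₁ ⁅a i, c₂⁆]
      abel
    have hsum : (∑ i, ∑ j, X i j) - ∑ i, ∑ j, Y i j =
        ∑ i, mk ((merge i).1 ∘ f) (Function.update a i ⁅a i, ⁅c₁, c₂⁆⁆) := by
      rw [Finset.sum_comm (f := Y), ← Finset.sum_sub_distrib]
      refine Finset.sum_congr rfl fun i _ => ?_
      rw [← Finset.sum_sub_distrib, Finset.sum_eq_single i, hXX i]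
      · intro j _ hj
        rw [hXY i j hj, sub_self]
      · intro h; exact absurd (Finset.mem_univ i) h
    rw [muTilde_mk hf ha hc, ← hsum]
    exact sub_mem (Submodule.sum_mem _ fun i _ => (k₁ i).1)
      (Submodule.sum_mem _ fun i _ => (k₂ i).1)
  · intro S f a hf ha hS
    obtain ⟨φ, hφ⟩ := hlin f a hf ha
    have := hφ 0
    rw [map_zero, Submodule.coe_zero] at this
    rw [← this]
    exact zero_mem _
  · intro S c d hc hd hc' hd' f a hf ha hS
    obtain ⟨φ, hφ⟩ := hlin f a hf ha
    have := hφ (⟨c, hS ▸ hc⟩ + ⟨d, hS ▸ hd⟩)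
    rw [map_add, hφ, hφ] at this
    exact this ▸ add_mem (hc' f a hf ha hS) (hd' f a hf ha hS)
  · intro S r c hc hc' f a hf ha hS
    obtain ⟨φ, hφ⟩ := hlin f a hf ha
    have := hφ (r • ⟨c, hS ▸ hc⟩)
    rw [map_smul, hφ] at this
    exact this ▸ Submodule.smul_mem _ r (hc' f a hf ha hS)

theorem muTilde_mem {m n : ℕ} (x : CatLieHom m (n + 1)) :
    muTilde m n x ∈ LinearMap.range (muTilde1 m n) := by
  induction x using hom_induction with
  | zero => rw [map_zero]; exact zero_mem _
  | add x y hx hy => rw [map_add]; exact add_mem hx hy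
  | smul r x hx => rw [map_smul]; exact Submodule.smul_mem _ _ hx
  | hpure f a =>
    have := muTilde_mem_aux (n := n) (a (Fin.last n)).2 f.1 (fun i => (a i.castSucc : FreeLie m))
      f.2 (fun i => (a i.castSucc).2) rfl
    rw [pure_eq_mk]
    convert this using 3
    funext i
    induction i using Fin.lastCases <;> simp

theorem comp_muTilde_mem {l m n : ℕ} (x : CatLieHom l m) (y : CatLieHom m (n + 1)) :
    comp x (muTilde m n y) ∈ LinearMap.range (muTilde1 l n) := by
  have : comp x (muTilde m n y) = muTilde l n (comp x y) := (comp_assoc x y (mu n)).symm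
  rw [this]
  exact muTilde_mem _

theorem muTilde_comp_mk {m n t : ℕ} {f : Fin m → Fin (n + 1)} {a : Fin n → FreeLie m}
    {c : FreeLie m} (hf : Function.Surjective f) (ha : ∀ i, a i ∈ LieOn (fibre f i.castSucc))
    (hc : c ∈ LieOn (fibre f (Fin.last n))) {g : Fin n → Fin t} {b : Fin t → FreeLie n}
    (hb : Valid g b) :
    comp (muTilde m n (mk f (Fin.snoc (α := fun _ => FreeLie m) a c))) (mk g b) =
      muTilde m t (mk (Fin.snoc (α := fun _ => Fin (t + 1)) (fun j => (g j).castSucc) (Fin.last t)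
        ∘ f) (Fin.snoc (α := fun _ => FreeLie m) (fun k => subst a (b k)) c)) := by
  set g' : Fin (n + 1) → Fin (t + 1) :=
    Fin.snoc (α := fun _ => Fin (t + 1)) (fun j => (g j).castSucc) (Fin.last t) with hg'
  have hv := valid_snoc hf ha hc
  have hs' : Function.Surjective g' := by
    intro k
    induction k using Fin.lastCases with
    | last => exact ⟨Fin.last n, by simp [hg']⟩
    | cast k =>
      obtain ⟨j, hj⟩ := hb.1 k
      exact ⟨j.castSucc, by simp [hg', hj]⟩
  have hfl : fibre (g' ∘ f) (Fin.last t) = fibre f (Fin.last n) := by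
    ext p
    rw [mem_fibre, mem_fibre, Function.comp_apply]
    generalize f p = q
    induction q using Fin.lastCases with
    | last => simp [hg']
    | cast q => simp [hg', Fin.castSucc_ne_last]
  have hfk : ∀ k, (fibre g k).biUnion (fun j => fibre f j.castSucc) =
      fibre (g' ∘ f) k.castSucc := by
    intro k
    ext p
    simp only [Finset.mem_biUnion, mem_fibre, Function.comp_apply]
    generalize f p = q
    induction q using Fin.lastCases with
    | last => simp [hg', (Fin.castSucc_ne_last _).symm]
    | cast q => simp [hg']
  have hsub : ∀ k, subst a (b k) ∈ LieOn (fibre (g' ∘ f) k.castSucc) := by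
    intro k
    rw [← hfk k]
    exact subst_mem (T := fun j => fibre f j.castSucc)
      (fun i j h => fibre_disjoint f _ _ fun e => h (Fin.castSucc_injective n e))
      (fun j _ => ha j) (hb.2 k)
  rw [muTilde_mk (hs'.comp hf) hsub (hfl ▸ hc), muTilde_mk hf ha hc, map_sum,
    LinearMap.sum_apply, ← Finset.sum_fiberwise _ g]
  refine Finset.sum_congr rfl fun k _ => ?_
  have hvi : ∀ i, Valid ((merge i).1 ∘ f) (Function.update a i ⁅a i, c⁆) := by
    intro i
    have := valid_comp hv (muGen_valid i)
    rw [subst_muGen] at this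
    simpa using this
  have hgk : ∀ i, g i = k → g ∘ ((merge i).1 ∘ f) = (merge k).1 ∘ (g' ∘ f) := by
    rintro i rfl
    funext p
    simp only [Function.comp_apply]
    generalize f p = q
    induction q using Fin.lastCases with
    | last => simp [hg']
    | cast q => simp [hg']
  have hbk : ∀ i, g i = k → (fun l => subst (Function.update a i ⁅a i, c⁆) (b l)) =
      Function.update (fun l => subst a (b l)) k (subst (Function.update a i ⁅a i, c⁆) (b k)) := by
    rintro i rfl
    funext l
    rcases eq_or_ne l (g i) with rfl | h
    · simp
    · rw [Function.update_of_ne h, subst_update_of_notMem a (by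
        rw [mem_fibre]; exact h.symm) _ (hb.2 l)]
  have hmem : ∀ i, g i = k → subst (Function.update a i ⁅a i, c⁆) (b k) ∈
      LieOn (fibre ((merge k).1 ∘ (g' ∘ f)) k) := by
    intro i hi
    rw [← hgk i hi]
    exact (valid_comp (hvi i) hb).2 k
  have hs : Function.Surjective ((merge k).1 ∘ (g' ∘ f)) := (merge k).2.comp (hs'.comp hf)
  have hother : ∀ l, l ≠ k → subst a (b l) ∈ LieOn (fibre ((merge k).1 ∘ (g' ∘ f)) l) := by
    intro l hl
    have : fibre ((merge k).1 ∘ (g' ∘ f)) l = fibre (g' ∘ f) l.castSucc := by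
      ext p
      rw [mem_fibre, mem_fibre, Function.comp_apply]
      generalize (g' ∘ f) p = q
      induction q using Fin.lastCases with
      | last => simp [hl.symm, (Fin.castSucc_ne_last l).symm]
      | cast q => simp
    rw [this]
    exact hsub l
  have hderiv := subst_deriv a c (hb.2 k)
  have e : ∀ z, z ∈ LieOn (fibre ((merge k).1 ∘ (g' ∘ f)) k) →
      ∃ w : (LieOn (fibre ((merge k).1 ∘ (g' ∘ f)) k) : Submodule ℚ (FreeLie m)),
        (w : FreeLie m) = z := fun z hz => ⟨⟨z, hz⟩, rfl⟩
  let w : Fin n → (LieOn (fibre ((merge k).1 ∘ (g' ∘ f)) k) : Submodule ℚ (FreeLie m)) :=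
    fun i => if h : g i = k then ⟨_, hmem i h⟩ else 0
  have hw : ((∑ i ∈ fibre g k, w i : (LieOn (fibre ((merge k).1 ∘ (g' ∘ f)) k) :
      Submodule ℚ (FreeLie m))) : FreeLie m) = ⁅subst a (b k), c⁆ := by
    rw [Submodule.coe_sum, ← hderiv]
    refine Finset.sum_congr rfl fun i hi => ?_
    simp [w, mem_fibre.1 hi]
  rw [← hw, ← mkLin_apply _ _ k hs hother, map_sum]
  refine Finset.sum_congr rfl fun i hi => ?_
  have hi' : g i = k := mem_fibre.1 hi
  rw [mkLin_apply, comp_mk (hvi i) hb, hgk i hi', hbk i hi']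
  simp [w, hi']

/-- Centrality of the `μ(n)`. -/
theorem mu_comp {n t : ℕ} (y : CatLieHom n t) : comp (mu n) y = comp (shift y) (mu t) := by
  induction y using hom_induction with
  | zero => simp only [map_zero, LinearMap.zero_apply]
  | add x x' h h' => simp only [map_add, LinearMap.add_apply, h, h']
  | smul r x h => simp only [map_smul, LinearMap.smul_apply, h]
  | hpure g b =>
  have h := muTilde_comp_mk (m := n + 1) (f := id) (a := fun i => FreeLieAlgebra.of ℚ i.castSucc)
    (c := FreeLieAlgebra.of ℚ (Fin.last n)) Function.surjective_id
    (fun i => by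
      have : fibre id i.castSucc = {i.castSucc} := by ext; simp [fibre]
      rw [this]; exact of_mem_LieOn _)
    (by
      have : fibre id (Fin.last n) = {Fin.last n} := by ext; simp [fibre]
      rw [this]; exact of_mem_LieOn _)
    (g := g.1) (b := fun k => (b k : FreeLie n)) ⟨g.2, fun k => (b k).2⟩
  have e₁ : mk id (Fin.snoc (α := fun _ => FreeLie (n + 1))
      (fun i => FreeLieAlgebra.of ℚ i.castSucc) (FreeLieAlgebra.of ℚ (Fin.last n))) =
      idHom (n + 1) := by
    rw [idHom, pure_eq_mk]
    congr 1
    funext i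
    induction i using Fin.lastCases <;> simp
  have e₂ : muTilde (n + 1) n (idHom (n + 1)) = mu n := id_comp (mu n)
  rw [e₁, e₂, ← pure_eq_mk] at h
  rw [h, shift_pure, pure_eq_mk]
  change muTilde _ _ _ = muTilde _ _ _
  congr 2
  funext i
  induction i using Fin.lastCases with
  | last => rw [Fin.snoc_last, coe_shiftComponents_last]
  | cast i => rw [Fin.snoc_castSucc, coe_shiftComponents_castSucc, weaken]

theorem muTilde_comp_mem {m n t : ℕ} (x : CatLieHom m (n + 1)) (y : CatLieHom n t) :
    comp (muTilde m n x) y ∈ LinearMap.range (muTilde1 m t) := by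
  induction x using hom_induction with
  | zero => rw [map_zero, map_zero, LinearMap.zero_apply]; exact zero_mem _
  | add x y hx hy => rw [map_add, map_add, LinearMap.add_apply]; exact add_mem hx hy
  | smul r x hx => rw [map_smul, map_smul, LinearMap.smul_apply]; exact Submodule.smul_mem _ _ hx
  | hpure f a =>
  induction y using hom_induction with
  | zero => rw [map_zero]; exact zero_mem _
  | add x y hx hy => rw [map_add]; exact add_mem hx hy
  | smul r x hx => rw [map_smul]; exact Submodule.smul_mem _ _ hx
  | hpure g b =>
    have h := muTilde_comp_mk f.2 (fun i => (a i.castSucc).2) (a (Fin.last n)).2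
      (g := g.1) (b := fun k => (b k : FreeLie n)) ⟨g.2, fun k => (b k).2⟩
    have h' : (Fin.snoc (α := fun _ => FreeLie m) (fun i => (a i.castSucc : FreeLie m))
        (a (Fin.last n) : FreeLie m)) = fun i => (a i : FreeLie m) := by
      funext i
      induction i using Fin.lastCases <;> simp
    rw [h', ← pure_eq_mk, ← pure_eq_mk] at h
    rw [h]
    exact muTilde_mem _

/-! ### The categories -/

/-- `CatLie(m, n)` modulo the image of the differential: the degree zero homology of the two-term
complex `δ⁽¹⁾CatLie(m, n) → CatLie(m, n)`, which is the complex of morphisms from `m` to `n` in the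
differential graded category `CatLie ⊕ δ⁽¹⁾CatLie[1]`. -/
abbrev H0Hom (m n : ℕ) : Type := CatLieHom m n ⧸ LinearMap.range (muTilde1 m n)

/-- The composition induced on `H0` by that of `CatLie`, in diagrammatic order. -/
def H0comp {m n t : ℕ} : H0Hom m n →ₗ[ℚ] H0Hom n t →ₗ[ℚ] H0Hom m t :=
  Submodule.liftQ _
    (LinearMap.flip <| Submodule.liftQ _
      (LinearMap.flip (comp.compr₂ (LinearMap.range (muTilde1 m t)).mkQ))
      (by
        rintro _ ⟨y, rfl⟩
        ext x
        exact (Submodule.Quotient.mk_eq_zero _).2 (comp_muTilde_mem x y.1)))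
    (by
      rintro _ ⟨x, rfl⟩
      refine LinearMap.ext fun y => ?_
      obtain ⟨y, rfl⟩ := Submodule.Quotient.mk_surjective _ y
      exact (Submodule.Quotient.mk_eq_zero _).2 (muTilde_comp_mem x.1 y))

theorem H0comp_mk {m n t : ℕ} (x : CatLieHom m n) (y : CatLieHom n t) :
    H0comp (Submodule.Quotient.mk x : H0Hom m n) (Submodule.Quotient.mk y : H0Hom n t) =
      Submodule.Quotient.mk (comp x y) := rfl

end LieOperad

open LieOperad

/-- The `ℚ`-linear category `CatLie`: its objects are the natural numbers. -/
structure CatLie where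
  arity : ℕ

namespace CatLie

instance : Category CatLie where
  Hom X Y := CatLieHom X.arity Y.arity
  id X := idHom X.arity
  comp f g := LieOperad.comp f g
  id_comp f := LieOperad.id_comp f
  comp_id f := LieOperad.comp_id f
  assoc f g h := LieOperad.comp_assoc f g h

instance : Preadditive CatLie where
  homGroup X Y := inferInstanceAs (AddCommGroup (CatLieHom X.arity Y.arity))
  add_comp _ _ _ f f' g := LinearMap.map_add₂ LieOperad.comp f f' g
  comp_add X Y Z f g g' :=
    LinearMap.map_add (LieOperad.comp (m := X.arity) (n := Y.arity) (t := Z.arity) f) g g'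

instance : Linear ℚ CatLie where
  homModule X Y := inferInstanceAs (Module ℚ (CatLieHom X.arity Y.arity))
  smul_comp _ _ _ r f g := LinearMap.map_smul₂ LieOperad.comp r f g
  comp_smul X Y Z f r g :=
    LinearMap.map_smul (LieOperad.comp (m := X.arity) (n := Y.arity) (t := Z.arity) f) r g

end CatLie

/-- The `ℚ`-linear category `H0`: its objects are the natural numbers. -/
structure H0 where
  arity : ℕ

namespace H0

instance : Category H0 where
  Hom X Y := H0Hom X.arity Y.arity
  id X := Submodule.Quotient.mk (idHom X.arity)
  comp f g := H0comp f g
  id_comp f := by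
    obtain ⟨f, rfl⟩ := Submodule.Quotient.mk_surjective _ f
    exact congrArg _ (LieOperad.id_comp f)
  comp_id f := by
    obtain ⟨f, rfl⟩ := Submodule.Quotient.mk_surjective _ f
    exact congrArg _ (LieOperad.comp_id f)
  assoc f g h := by
    obtain ⟨f, rfl⟩ := Submodule.Quotient.mk_surjective _ f
    obtain ⟨g, rfl⟩ := Submodule.Quotient.mk_surjective _ g
    obtain ⟨h, rfl⟩ := Submodule.Quotient.mk_surjective _ h
    exact congrArg _ (LieOperad.comp_assoc f g h)

instance : Preadditive H0 where
  homGroup X Y := inferInstanceAs (AddCommGroup (H0Hom X.arity Y.arity))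
  add_comp _ _ _ f f' g := LinearMap.map_add₂ H0comp f f' g
  comp_add X Y Z f g g' :=
    LinearMap.map_add (H0comp (m := X.arity) (n := Y.arity) (t := Z.arity) f) g g'

instance : Linear ℚ H0 where
  homModule X Y := inferInstanceAs (Module ℚ (H0Hom X.arity Y.arity))
  smul_comp _ _ _ r f g := LinearMap.map_smul₂ H0comp r f g
  comp_smul X Y Z f r g :=
    LinearMap.map_smul (H0comp (m := X.arity) (n := Y.arity) (t := Z.arity) f) r g

end H0

/-- The projection `CatLie ⥤ H0`: the identity on objects, the quotient map on morphisms. -/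
def CatLie.toH0 : CatLie ⥤ H0 where
  obj X := ⟨X.arity⟩
  map {X Y} f := (LinearMap.range (muTilde1 X.arity Y.arity)).mkQ f
  map_id _ := rfl
  map_comp _ _ := rfl

instance CatLie.toH0_additive : CatLie.toH0.Additive where
  map_add := rfl

instance CatLie.toH0_linear : CatLie.toH0.Linear ℚ where
  map_smul _ _ := rfl

/-- The category of left modules over a `ℚ`-linear category `C`: the `ℚ`-linear functors from `C` to
`ℚ`-vector spaces, with natural transformations as morphisms. -/
abbrev LeftMod (C : Type) [Category.{0} C] [Preadditive C] [Linear ℚ C] : Type (u + 1) :=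
  ObjectProperty.FullSubcategory
    (fun F : C ⥤ ModuleCat.{u} ℚ => F.Additive ∧ F.Linear ℚ)

/-- Restriction of left modules along a `ℚ`-linear functor. -/
def LeftMod.restrict {C D : Type} [Category.{0} C] [Preadditive C] [Linear ℚ C]
    [Category.{0} D] [Preadditive D] [Linear ℚ D] (p : C ⥤ D) [p.Additive] [p.Linear ℚ] :
    LeftMod.{u} D ⥤ LeftMod.{u} C :=
  ObjectProperty.lift _
    (ObjectProperty.ι _ ⋙ (Functor.whiskeringLeft C D (ModuleCat.{u} ℚ)).obj p)
    (fun M => by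
      have := M.property.1
      have := M.property.2
      exact ⟨inferInstanceAs (p ⋙ M.obj).Additive, inferInstanceAs ((p ⋙ M.obj).Linear ℚ)⟩)

/-- The functor `- ⊞ 1` from `CatLie` to itself. -/
def CatLie.addOne : CatLie ⥤ CatLie where
  obj X := ⟨X.arity + 1⟩
  map f := LieOperad.shift f
  map_id X := LieOperad.shift_id X.arity
  map_comp f g := LieOperad.shift_comp f g

instance CatLie.addOne_additive : CatLie.addOne.Additive where
  map_add {X Y f g} :=
    LinearMap.map_add (LieOperad.shift (m := X.arity) (n := Y.arity)) f g

instance CatLie.addOne_linear : CatLie.addOne.Linear ℚ where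
  map_smul {X Y} f r :=
    LinearMap.map_smul (LieOperad.shift (m := X.arity) (n := Y.arity)) r f

/-- The shift functor `δ` on left `CatLie`-modules: `(δM)(n) = M(n + 1)`. -/
def delta : LeftMod.{u} CatLie ⥤ LeftMod.{u} CatLie := LeftMod.restrict CatLie.addOne

/-- The `μ(n)` as a natural transformation from `- ⊞ 1` to the identity of `CatLie`. -/
def CatLie.muHom : CatLie.addOne ⟶ 𝟭 CatLie where
  app X := LieOperad.mu X.arity
  naturality X Y f := (LieOperad.mu_comp (n := X.arity) (t := Y.arity) f).symm

/-- The natural transformation `μ̃ : δ ⟶ Id`: in arity `n` it is the action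
`(δM)(n) = M(n + 1) ⟶ M(n)` of `μ(n)`. -/
def muNat : delta.{u} ⟶ 𝟭 (LeftMod.{u} CatLie) where
  app M := ObjectProperty.homMk
    { app := fun X => M.obj.map (CatLie.muHom.app X)
      naturality := fun _ _ f => (Functor.whiskerRight CatLie.muHom M.obj).naturality f }
  naturality M N φ := by
    ext X : 3
    exact (φ.hom.naturality (CatLie.muHom.app X)).symm

/-- The left `CatLie`-modules on which `μ̃` vanishes. -/
def muVanishes : ObjectProperty (LeftMod.{u} CatLie) := fun M => muNat.app M = 0

/-- The full subcategory of the left `CatLie`-modules on which `μ̃` vanishes. -/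
abbrev FLieMu : Type (u + 1) := muVanishes.{u}.FullSubcategory

end

noncomputable section

open LieOperad

/-! ### The projection onto the quotient by the image of the differential -/

namespace CatLie

/-! The category $\mathbf H_0$ is the quotient of $\mathbf{Cat}\,\mathfrak{Lie}$ by the two-sided
ideal that the $\mu(n)$ generate, so its left modules are the $\mathbf{Cat}\,\mathfrak{Lie}$-modules
on which every $\mu(n)$ acts by zero, and this is the condition $\widetilde\mu_M = 0$.

The substance lies in the ideal. The differential is defined only on $\delta^{(1)}$, and
precomposition does not preserve $\delta^{(1)}$, since it can enlarge the fibre over the last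
element. By `muTilde_mem`, however, $\widetilde\mu$ has the same image as its restriction to
$\delta^{(1)}$. The Jacobi identity $[a,[c,d]] = [[a,c],d] - [[a,d],c]$ splits a bracket in the last
place, and the terms in which $c$ and $d$ land in different components cancel. Hence the image is
stable under precomposition. Stability under postcomposition is the centrality of $\mu$, which holds
because bracketing with a fixed element is a derivation (`subst_deriv`). These facts already
underlie the composition of $\mathbf H_0$.

What remains is formal. The ideal contains $\mu(n)$ (`mu_mem_range`), so $\mu$ acts by zero on every
restricted module. Conversely, each element of the ideal is a composite ending in some $\mu(n)$, so
a module with $\widetilde\mu_M = 0$ kills it (`muVanishes.map_eq_zero`) and descends to the quotient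
(`muVanishes.desc`). Since the projection is full and bijective on objects, restriction along it is
fully faithful, and descent makes it essentially surjective onto $\mathcal
F^{\mu}_{\mathfrak{Lie}}$. -/

theorem mu_mem_range (n : ℕ) : mu n ∈ LinearMap.range (muTilde1 (n + 1) n) := by
  -- The preimage is the identity of $n+1$. It lies in $\delta^{(1)}$, its last fibre being a
  -- singleton, but `muTilde_mem` spares that check.
  have h : muTilde (n + 1) n (idHom (n + 1)) = mu n := LieOperad.id_comp (mu n)
  exact h ▸ muTilde_mem _

theorem toH0_map_muHom (X : CatLie) : toH0.map (muHom.app X) = 0 :=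
  (Submodule.Quotient.mk_eq_zero _).2 (mu_mem_range X.arity)

/-- An equational form of fullness. By eta for structures every object of `H0` is definitionally in
the image of `toH0`, so this lifts arbitrary morphisms of `H0`. -/
theorem toH0_map_surjective {X Y : CatLie} (g : toH0.obj X ⟶ toH0.obj Y) :
    ∃ f : X ⟶ Y, toH0.map f = g :=
  Submodule.Quotient.mk_surjective _ g

instance toH0_full : toH0.Full where
  map_surjective g := toH0_map_surjective g

end CatLie

/-! ### Modules killed by $\mu$ and their descent to $\mathbf H_0$ -/

theorem muVanishes.map_muHom {M : LeftMod.{u} CatLie} (hM : muVanishes M) (X : CatLie) :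
    M.obj.map (CatLie.muHom.app X) = 0 :=
  congrArg (fun φ => φ.hom.app X) hM

/-- The action of $\mu(n)$ on a restricted module is the action of its class in $\mathbf H_0$, which
is zero. -/
theorem muVanishes_restrict (N : LeftMod.{u} H0) :
    muVanishes ((LeftMod.restrict CatLie.toH0).obj N) := by
  -- Additivity of `N.obj` is what makes it send the zero morphism to zero.
  have := N.property.1
  refine ObjectProperty.hom_ext _ (NatTrans.ext (funext fun X => ?_))
  exact (congrArg N.obj.map (CatLie.toH0_map_muHom X)).trans (Functor.map_zero _ _ _)

/-- A module on which `μ̃` vanishes kills the image of the differential. -/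
theorem muVanishes.map_eq_zero {M : LeftMod.{u} CatLie} (hM : muVanishes M) {X Y : CatLie}
    (f : X ⟶ Y) (hf : f ∈ LinearMap.range (muTilde1 X.arity Y.arity)) : M.obj.map f = 0 := by
  obtain ⟨x, rfl⟩ := hf
  -- Membership of `x` in $\delta^{(1)}$ is forgotten here: any composite with $\mu$ as its last
  -- factor is killed. Giving `x.1` a categorical type turns the differential, by definition, into
  -- the composite in the next line.
  let x' : X ⟶ CatLie.addOne.obj Y := x.1
  change M.obj.map (x' ≫ CatLie.muHom.app Y) = 0
  rw [Functor.map_comp, hM.map_muHom]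
  exact Limits.comp_zero

/-- The action of `H0` on a module on which `μ̃` vanishes. -/
def muVanishes.descMap {M : LeftMod.{u} CatLie} (hM : muVanishes M) (X Y : CatLie) :
    H0Hom X.arity Y.arity →ₗ[ℚ] (M.obj.obj X ⟶ M.obj.obj Y) :=
  have := M.property.1
  have := M.property.2
  -- Linearity of the functor `M.obj` is needed so that its action on each morphism space can factor
  -- through a quotient of vector spaces.
  Submodule.liftQ _ (Functor.mapLinearMap ℚ M.obj : (X ⟶ Y) →ₗ[ℚ] _)
    fun f hf => hM.map_eq_zero f hf

/-- The left `H0`-module given by a left `CatLie`-module on which `μ̃` vanishes. -/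
def muVanishes.desc {M : LeftMod.{u} CatLie} (hM : muVanishes M) : LeftMod.{u} H0 where
  obj :=
    { obj := fun X => M.obj.obj ⟨X.arity⟩
      map := fun {X Y} f => hM.descMap ⟨X.arity⟩ ⟨Y.arity⟩ f
      -- Identities of `H0` are classes of identities and `liftQ` computes on representatives, so
      -- the law for `M` applies verbatim.
      map_id := fun X => M.obj.map_id ⟨X.arity⟩
      map_comp := fun {X Y Z} f g => by
        -- With representatives chosen, functoriality reduces to that of `M`.
        obtain ⟨f, rfl⟩ := CatLie.toH0_map_surjective (X := ⟨X.arity⟩) (Y := ⟨Y.arity⟩) f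
        obtain ⟨g, rfl⟩ := CatLie.toH0_map_surjective (X := ⟨Y.arity⟩) (Y := ⟨Z.arity⟩) g
        exact M.obj.map_comp f g }
  property :=
    ⟨{ map_add := fun {X Y f g} => map_add (hM.descMap ⟨X.arity⟩ ⟨Y.arity⟩) f g },
      { map_smul := fun {X Y} f r => map_smul (hM.descMap ⟨X.arity⟩ ⟨Y.arity⟩) r f }⟩

/-! ### Restriction as an equivalence -/

/-- Restriction along `CatLie ⥤ H0`, with values in the modules on which `μ̃` vanishes. -/
def LeftMod.restrictToH0 : LeftMod.{u} H0 ⥤ FLieMu.{u} :=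
  ObjectProperty.lift _ (LeftMod.restrict CatLie.toH0) muVanishes_restrict

/-- Restriction leaves the components of a natural transformation unchanged, and no object of `H0`
is missed by the projection. -/
instance LeftMod.restrictToH0_faithful : LeftMod.restrictToH0.{u}.Faithful where
  map_injective {M N} φ ψ h := by
    refine ObjectProperty.hom_ext _ (NatTrans.ext (funext fun X => ?_))
    exact congrArg (fun θ => θ.hom.hom.app (⟨X.arity⟩ : CatLie)) h

/-- The same components serve over `H0`; only naturality is at stake, and fullness of the projection
supplies it. -/
instance LeftMod.restrictToH0_full : LeftMod.restrictToH0.{u}.Full where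
  map_surjective {M N} φ := by
    refine ⟨ObjectProperty.homMk
      { app := fun X => φ.hom.hom.app ⟨X.arity⟩
        naturality := fun X Y f => ?_ }, rfl⟩
    -- The naturality square of a morphism of `H0` is that of any of its lifts.
    obtain ⟨f, rfl⟩ := CatLie.toH0_map_surjective (X := ⟨X.arity⟩) (Y := ⟨Y.arity⟩) f
    exact φ.hom.hom.naturality f

instance LeftMod.restrictToH0_essSurj : LeftMod.restrictToH0.{u}.EssSurj where
  -- Descending and then restricting returns `M` definitionally: lifting to the quotient and
  -- composing with the projection recovers the original action. Hence the identity isomorphism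
  -- suffices.
  mem_essImage M := ⟨M.property.desc, ⟨Iso.refl M⟩⟩

instance LeftMod.restrictToH0_isEquivalence : LeftMod.restrictToH0.{u}.IsEquivalence where

end

theorem mainTheorem5 :
    (CatLie.toH0.Full ∧ CatLie.toH0.Additive ∧ CatLie.toH0.Linear ℚ) ∧
      ∃ e : FLieMu.{u} ≌ LeftMod.{u} H0,
        Nonempty (e.functor ⋙ LeftMod.restrict.{u} CatLie.toH0 ≅ muVanishes.{u}.ι) :=
  -- Restriction goes from `H0`-modules to $\mathcal F^{\mu}_{\mathfrak{Lie}}$, opposite to the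
  -- direction required, hence `symm`; the functor of the equivalence is thus a quasi-inverse of
  -- restriction.
  ⟨⟨inferInstance, inferInstance, inferInstance⟩, LeftMod.restrictToH0.asEquivalence.symm,
    -- The counit compares "quasi-inverse, then restriction" with the identity of $\mathcal
    -- F^{\mu}_{\mathfrak{Lie}}$. Whiskering with the inclusion gives the claim, because
    -- `restrictToH0` followed by the inclusion is by definition restriction along `toH0`.
    ⟨Functor.isoWhiskerRight LeftMod.restrictToH0.asEquivalence.counitIso muVanishes.ι⟩⟩
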